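/- An equivalence structure is a structure $\langle\omega,R\rangle$ where $R$ is an equivalence relation on $\omega$; it is called $\Pi^0_1$ (respectively $\Delta^0_2$) if $R$, as a subset of $\omega\times\omega$, is $\Pi^0_1$ (respectively $\Delta^0_2$) in the arithmetical hierarchy. For a class $\Gamma$ of subsets of $\omega\times\omega$, let $\operatorname{IsoType}(\mathbb{EQ},\Gamma)$ be the collection of all isomorphism types of equivalence structures $\langle\omega,R\rangle$ with $R\in\Gamma$. Theorem. The isomorphism types of $\Pi^0_1$ and $\Delta^0_2$ equivalence structures coincide. That is, $$\operatorname{IsoType}(\mathbb{EQ},\Pi^0_1)=\operatorname{IsoType}(\mathbb{EQ},\Delta^0_2).$$ -/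

import Mathlib

/-- `IsSigma0 n P`: the predicate `P` is `Σ⁰ₙ` in the arithmetical hierarchy. A `Σ⁰₀` predicate is a
computable one, and a `Σ⁰ₙ₊₁` predicate is one of the form `∃ m, T (x, m)` with `T` the complement
of a `Σ⁰ₙ` predicate (that is, with `T` a `Π⁰ₙ` predicate). -/
def IsSigma0 : ℕ → ∀ {α : Type} [Primcodable α], (α → Prop) → Prop
  | 0, _, _, P => ComputablePred P
  | n + 1, α, _, P => ∃ Q : α × ℕ → Prop, IsSigma0 n Q ∧ ∀ x, P x ↔ ∃ m, ¬ Q (x, m)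

/-- `P` is `Π⁰ₙ`: its complement is `Σ⁰ₙ`. -/
def IsPi0 (n : ℕ) {α : Type} [Primcodable α] (P : α → Prop) : Prop :=
  IsSigma0 n fun x => ¬ P x

/-- `P` is `Δ⁰ₙ`: both `Σ⁰ₙ` and `Π⁰ₙ`. -/
def IsDelta0 (n : ℕ) {α : Type} [Primcodable α] (P : α → Prop) : Prop :=
  IsSigma0 n P ∧ IsPi0 n P

/-- Isomorphism of the structures `⟨ℕ, R⟩` and `⟨ℕ, S⟩`, where `R` and `S` are binary relations:
there is a bijection `f` of `ℕ` with `S (f x) (f y) ↔ R x y` for all `x`, `y`. -/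
def relIsoSetoid : Setoid (ℕ → ℕ → Prop) where
  r R S := Nonempty (R ≃r S)
  iseqv :=
    { refl := fun R => ⟨RelIso.refl R⟩
      symm := fun ⟨f⟩ => ⟨f.symm⟩
      trans := fun ⟨f⟩ ⟨g⟩ => ⟨f.trans g⟩ }

/-- The equivalence structures `⟨ℕ, R⟩`. -/
def EQ : Set (ℕ → ℕ → Prop) := {R | Equivalence R}

/-- `IsoType K Γ`: the collection of all isomorphism types realized by the structures `⟨ℕ, R⟩` in
the class `K` such that `R`, as a set of pairs, is in `Γ`. -/
def IsoType (K : Set (ℕ → ℕ → Prop)) (Γ : (ℕ × ℕ → Prop) → Prop) : Set (Quotient relIsoSetoid) :=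
  Quotient.mk relIsoSetoid '' {R | R ∈ K ∧ Γ fun p => R p.1 p.2}

/-! Only the passage from a `Δ⁰₂` relation `R` to a `Π⁰₁` copy needs work. With finitely many
classes `R` has a computable copy (`exists_isPi0_relIso_of_finite`). Otherwise number the classes by
their least elements `c k`. By the limit lemma, "`i` lies in class `k` and `i ≠ c k`" holds iff a
computable `d (Nat.pair k i)` is eventually false.

The copy has a position `p = Nat.pair k i` for each such claim. Its occupant sits in block `k`, and
is thrown out and replaced whenever `d` rejects the claim; at other stages a fresh element is thrown
out instead. So each stage `t` throws exactly one element out of `p`, and this element founds the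
block `Nat.pair p t`. Every number is the label of exactly one such event, so block `k` ends up with
one founder, matching `c k`, and one permanent occupant for each other member of class `k`
(`exists_isPi0_relIso`).

Elements move at most once, and a late move leads to a label too large for any older non-founder.
Hence two elements apart at a stage beyond both stay apart, which makes equivalence `Π⁰₁`
(`block_eq_block_iff`). -/

/-! ### Computable functions and the low levels of the arithmetical hierarchy -/

section Computability

variable {α : Type} [Primcodable α]

theorem Computable.and' {f g : α → Bool} (hf : Computable f) (hg : Computable g) :
    Computable fun a => f a && g a :=
  (Primrec.and.to_comp : Computable₂ and).comp hf hg

theorem Computable.not' {f : α → Bool} (hf : Computable f) : Computable fun a => !f a :=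
  Primrec.not.to_comp.comp hf

theorem Computable.natBeq {f g : α → ℕ} (hf : Computable f) (hg : Computable g) :
    Computable fun a => f a == g a :=
  (Primrec.beq.to_comp : Computable₂ (@BEq.beq ℕ _)).comp hf hg

theorem Computable.natPair {f g : α → ℕ} (hf : Computable f) (hg : Computable g) :
    Computable fun a => Nat.pair (f a) (g a) :=
  (Primrec₂.natPair.to_comp : Computable₂ Nat.pair).comp hf hg

theorem computablePred_iff_exists_bool {P : α → Prop} :
    ComputablePred P ↔ ∃ f : α → Bool, Computable f ∧ ∀ x, P x ↔ f x = true := by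
  constructor
  · rintro ⟨h, hc⟩
    exact ⟨_, hc, fun x => by simp⟩
  · rintro ⟨f, hf, h⟩
    let : DecidablePred P := fun x => decidable_of_iff _ (h x).symm
    exact ⟨this, hf.of_eq fun x => by rw [Bool.eq_iff_iff, decide_eq_true_iff, h]⟩

/-- Bounded universal quantification of a Boolean function. -/
def boundedAll (f : ℕ → Bool) (n : ℕ) : Bool :=
  Nat.rec true (fun m b => b && f m) n

theorem boundedAll_eq_true {f : ℕ → Bool} {n : ℕ} :
    boundedAll f n = true ↔ ∀ m < n, f m = true := by
  induction n with
  | zero => simp [boundedAll]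
  | succ n ih =>
    change (boundedAll f n && f n) = true ↔ _
    rw [Bool.and_eq_true, ih]
    constructor
    · rintro ⟨h, h'⟩ m hm
      rcases Nat.lt_succ_iff_lt_or_eq.1 hm with h1 | rfl
      exacts [h m h1, h']
    · exact fun h => ⟨fun m hm => h m (by omega), h n (by omega)⟩

theorem Computable.boundedAll {f : α → ℕ → Bool} {g : α → ℕ} (hf : Computable₂ f)
    (hg : Computable g) : Computable fun a => boundedAll (f a) (g a) :=
  Computable.nat_rec (h := fun a (p : ℕ × Bool) => p.2 && f a p.1) hg (Computable.const true)
    (Computable.and' (Computable.snd.comp Computable.snd)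
      (hf.comp Computable.fst (Computable.fst.comp Computable.snd)))

theorem isPi0_one_iff {P : α → Prop} :
    IsPi0 1 P ↔ ∃ f : α × ℕ → Bool, Computable f ∧ ∀ x, P x ↔ ∀ m, f (x, m) = true := by
  simp only [IsPi0, IsSigma0, computablePred_iff_exists_bool]
  constructor
  · rintro ⟨Q, ⟨f, hf, hQ⟩, h⟩
    refine ⟨f, hf, fun x => ?_⟩
    rw [← not_iff_not, h]
    simp [hQ]
  · rintro ⟨f, hf, h⟩
    refine ⟨fun x => f x = true, ⟨f, hf, fun _ => Iff.rfl⟩, fun x => ?_⟩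
    rw [h, not_forall]

theorem isSigma0_two_iff {P : α → Prop} :
    IsSigma0 2 P ↔ ∃ f : (α × ℕ) × ℕ → Bool, Computable f ∧
      ∀ x, P x ↔ ∃ m, ∀ l, f ((x, m), l) = true := by
  constructor
  · rintro ⟨Q, hQ, h⟩
    have : IsPi0 1 fun x => ¬ Q x := by simpa [IsPi0] using hQ
    obtain ⟨f, hf, hf'⟩ := isPi0_one_iff.1 this
    exact ⟨f, hf, fun x => by simp only [h, hf']⟩
  · rintro ⟨f, hf, h⟩
    exact ⟨fun x => ¬ ∀ l, f (x, l) = true, isPi0_one_iff.2 ⟨f, hf, fun _ => Iff.rfl⟩,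
      fun x => by simp only [h, not_not]⟩

theorem IsPi0.isDelta0_two {P : α → Prop} (h : IsPi0 1 P) : IsDelta0 2 P := by
  obtain ⟨f, hf, hP⟩ := isPi0_one_iff.1 h
  constructor
  · refine isSigma0_two_iff.2 ⟨fun p => f (p.1.1, p.2), hf.comp
      ((Computable.fst.comp Computable.fst).pair Computable.snd), fun x => ?_⟩
    simp [hP]
  · refine isSigma0_two_iff.2 ⟨fun p => !f p.1, (hf.comp Computable.fst).not', fun x => ?_⟩
    simp [hP]

/-! ### The limit lemma -/

/-- The state `(m, l)` after `t` steps of the search for an `m` with `∀ l, V m l`: the candidate `m`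
has passed the tests below `l`, and the next candidate is tried once `m` fails a test. -/
def searchState (V : ℕ → ℕ → Bool) (t : ℕ) : ℕ × ℕ :=
  Nat.rec (0, 0) (fun _ p => cond (V p.1 p.2) (p.1, p.2 + 1) (p.1 + 1, 0)) t

theorem searchState_succ (V : ℕ → ℕ → Bool) (t : ℕ) :
    searchState V (t + 1) = cond (V (searchState V t).1 (searchState V t).2)
      ((searchState V t).1, (searchState V t).2 + 1) ((searchState V t).1 + 1, 0) := rfl

/-- The candidate never decreases and cannot pass `m`, which fails no test, so it stabilises; the
test counter then grows forever, so the limiting candidate passes every test. -/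
theorem exists_forall_searchState_eq {V : ℕ → ℕ → Bool} {m : ℕ} (hm : ∀ l, V m l = true) :
    ∃ n, (∀ l, V n l = true) ∧ ∃ t₀, ∀ t ≥ t₀, (searchState V t).1 = n := by
  have hle : ∀ t, (searchState V t).1 ≤ m := by
    intro t
    induction t with
    | zero => exact Nat.zero_le _
    | succ t ih =>
      rw [searchState_succ]
      cases h : V (searchState V t).1 (searchState V t).2 with
      | true => simpa using ih
      | false =>
        have : (searchState V t).1 ≠ m := fun h' => by rw [h', hm] at h; cases h
        simp only [cond_false]
        omega
  have hmono : Monotone fun t => (searchState V t).1 := by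
    refine monotone_nat_of_le_succ fun t => ?_
    rw [searchState_succ]
    cases V (searchState V t).1 (searchState V t).2 <;> simp
  obtain ⟨t₀, ht₀⟩ : ∃ t₀, ∀ t ≥ t₀, (searchState V t).1 = (searchState V t₀).1 := by
    have hfin : (Set.range fun t => (searchState V t).1).Finite :=
      (Set.finite_Iic m).subset (by rintro _ ⟨t, rfl⟩; exact hle t)
    obtain ⟨_, ⟨⟨t₀, rfl⟩, hmax⟩⟩ := hfin.exists_maximal (Set.range_nonempty _)
    exact ⟨t₀, fun t ht => le_antisymm (hmax ⟨t, rfl⟩ (hmono ht)) (hmono ht)⟩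
  refine ⟨(searchState V t₀).1, ?_, t₀, ht₀⟩
  have hinv : ∀ t, ∀ l < (searchState V t).2, V (searchState V t).1 l = true := by
    intro t
    induction t with
    | zero => intro l hl; exact absurd hl (Nat.not_lt_zero _)
    | succ t ih =>
      rw [searchState_succ]
      cases h : V (searchState V t).1 (searchState V t).2 with
      | true =>
        intro l hl
        rcases Nat.lt_succ_iff_lt_or_eq.1 hl with h1 | rfl
        exacts [ih l h1, h]
      | false => intro l hl; exact absurd hl (Nat.not_lt_zero _)
  have hgrow : ∀ k, k ≤ (searchState V (t₀ + k)).2 := by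
    intro k
    induction k with
    | zero => exact Nat.zero_le _
    | succ k ih =>
      have h1 := ht₀ (t₀ + k + 1) (by omega)
      have h2 := ht₀ (t₀ + k) (by omega)
      rw [← add_assoc]
      rw [searchState_succ] at h1 ⊢
      cases h : V (searchState V (t₀ + k)).1 (searchState V (t₀ + k)).2 with
      | true => simpa using ih
      | false => simp only [h, cond_false] at h1; omega
  intro l
  have h1 := hinv (t₀ + (l + 1)) l (hgrow (l + 1))
  rwa [ht₀ _ (by omega)] at h1

theorem Computable.searchState {V : α → ℕ → ℕ → Bool}
    (hV : Computable fun x : α × ℕ × ℕ => V x.1 x.2.1 x.2.2) :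
    Computable₂ fun a t => searchState (V a) t := by
  have hp : Computable fun x : (α × ℕ) × ℕ × ℕ × ℕ => x.2.2 := Computable.snd.comp Computable.snd
  refine Computable.nat_rec (α := α × ℕ) (f := Prod.snd) (g := fun _ => ((0, 0) : ℕ × ℕ))
    (h := fun (x : α × ℕ) (p : ℕ × ℕ × ℕ) =>
      _root_.cond (V x.1 p.2.1 p.2.2) (p.2.1, p.2.2 + 1) (p.2.1 + 1, 0))
    Computable.snd (Computable.const _) ?_
  exact Computable.cond
    (hV.comp ((Computable.fst.comp Computable.fst).pair hp))
    ((Computable.fst.comp hp).pair (Computable.succ.comp (Computable.snd.comp hp)))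
    ((Computable.succ.comp (Computable.fst.comp hp)).pair (Computable.const 0))

/-- The limit lemma: a `Δ⁰₂` predicate is the pointwise limit of a computable sequence. -/
theorem IsDelta0.exists_computable_limit {P : α → Prop} (h : IsDelta0 2 P) :
    ∃ r : α → ℕ → Bool, Computable₂ r ∧ ∀ x, ∀ᶠ t in Filter.atTop, (r x t = true ↔ P x) := by
  obtain ⟨f, hf, hP⟩ := isSigma0_two_iff.1 h.1
  obtain ⟨g, hg, hnP⟩ := isSigma0_two_iff.1 h.2
  -- Odd candidates code witnesses for `P`, even ones for its negation; some candidate always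
  -- succeeds, and the parity of the limiting one decides `P`.
  let V : α → ℕ → ℕ → Bool := fun a m l => cond m.bodd (f ((a, m.div2), l)) (g ((a, m.div2), l))
  have hV : Computable fun x : α × ℕ × ℕ => V x.1 x.2.1 x.2.2 := by
    have hm : Computable fun x : α × ℕ × ℕ => x.2.1 := Computable.fst.comp Computable.snd
    have ha : Computable fun x : α × ℕ × ℕ => ((x.1, x.2.1.div2), x.2.2) :=
      (Computable.fst.pair (Computable.nat_div2.comp hm)).pair
        (Computable.snd.comp Computable.snd)
    exact Computable.cond (Computable.nat_bodd.comp hm) (hf.comp ha) (hg.comp ha)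
  refine ⟨fun x t => (searchState (V x) t).1.bodd, Computable.nat_bodd.comp
    (Computable.fst.comp (Computable.searchState hV)), fun x => ?_⟩
  obtain ⟨m, hm⟩ : ∃ m, ∀ l, V x m l = true := by
    by_cases hx : P x
    · obtain ⟨m, hm⟩ := (hP x).1 hx
      exact ⟨Nat.bit true m, fun l => by simpa [V, -Nat.bit_true] using hm l⟩
    · obtain ⟨m, hm⟩ := (hnP x).1 hx
      exact ⟨Nat.bit false m, fun l => by simpa [V, -Nat.bit_false] using hm l⟩
  obtain ⟨n, hn, t₀, ht₀⟩ := exists_forall_searchState_eq hm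
  filter_upwards [Filter.eventually_ge_atTop t₀] with t ht
  rw [ht₀ t ht]
  cases hb : n.bodd with
  | true => simpa using (hP x).2 ⟨n.div2, by simpa [V, hb] using hn⟩
  | false => simpa using (hnP x).2 ⟨n.div2, by simpa [V, hb] using hn⟩

end Computability

/-! ### A single position and its thrown elements -/

/-- The occupant of a position before stage `t`, where a new occupant arrives at each stage at which
`d` holds. -/
def occupant (d : ℕ → Bool) (t : ℕ) : ℕ :=
  Nat.rec 0 (fun u o => cond (d u) (u + 1) o) t

/-- The element thrown out at stage `t`: the occupant if `d` holds, a new element otherwise. -/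
def thrown (d : ℕ → Bool) (t : ℕ) : ℕ :=
  cond (d t) (occupant d t) (t + 1)

theorem occupant_succ (d : ℕ → Bool) (t : ℕ) :
    occupant d (t + 1) = cond (d t) (t + 1) (occupant d t) := rfl

theorem occupant_le (d : ℕ → Bool) (t : ℕ) : occupant d t ≤ t := by
  induction t with
  | zero => exact le_rfl
  | succ t ih =>
    rw [occupant_succ]
    cases d t
    · simpa using ih.trans (Nat.le_succ t)
    · simp

theorem thrown_le (d : ℕ → Bool) (t : ℕ) : thrown d t ≤ t + 1 := by
  rw [thrown]
  cases d t
  · simp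
  · simpa using (occupant_le d t).trans (Nat.le_succ t)

theorem thrown_ne_occupant {d : ℕ → Bool} {u t : ℕ} (h : u < t) : thrown d u ≠ occupant d t := by
  induction t, h using Nat.le_induction with
  | base =>
    have := occupant_le d u
    rw [occupant_succ, thrown]
    cases d u <;> simp <;> omega
  | succ t ht ih =>
    have := thrown_le d u
    rw [occupant_succ]
    cases d t
    · simpa using ih
    · simp only [cond_true]; omega

/-- The occupant has never been thrown out before, and the new element `t + 1` exceeds everything
thrown out earlier. -/
theorem thrown_injective (d : ℕ → Bool) : Function.Injective (thrown d) := by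
  have hne : ∀ u t, u < t → thrown d u ≠ thrown d t := fun u t h => by
    have h1 := thrown_ne_occupant (d := d) h
    have h2 := thrown_le d u
    rw [thrown.eq_def d t]
    cases d t
    · simp only [cond_false]; omega
    · simpa using h1
  intro u t h
  rcases lt_trichotomy u t with h1 | h1 | h1
  exacts [absurd h (hne u t h1), h1, absurd h.symm (hne t u h1)]

/-- At stage `t` every `s ≤ t` is either the occupant or already thrown out. Hence at most one
element of a position is permanent. -/
theorem occupant_eq_of_not_mem_range {d : ℕ → Bool} {s t : ℕ} (h : s ∉ Set.range (thrown d))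
    (hst : s ≤ t) : occupant d t = s := by
  have key : ∀ t, ∀ s ≤ t, occupant d t = s ∨ ∃ u, thrown d u = s := by
    intro t
    induction t with
    | zero => intro s hs; exact Or.inl (Nat.le_zero.1 hs).symm
    | succ t ih =>
      intro s hs
      rw [occupant_succ]
      cases hd : d t with
      | false =>
        rcases Nat.le_succ_iff.1 hs with h1 | rfl
        · exact ih s h1
        · exact Or.inr ⟨t, by simp [thrown, hd]⟩
      | true =>
        rcases Nat.le_succ_iff.1 hs with h1 | rfl
        · rcases ih s h1 with h2 | h2
          · exact Or.inr ⟨t, by simpa [thrown, hd] using h2⟩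
          · exact Or.inr h2
        · exact Or.inl rfl
  exact (key t s hst).resolve_right h

theorem eventually_false_of_not_mem_range {d : ℕ → Bool} {s : ℕ} (h : s ∉ Set.range (thrown d)) :
    ∀ᶠ t in Filter.atTop, d t = false := by
  filter_upwards [Filter.eventually_ge_atTop s] with t ht
  by_contra hd
  rw [Bool.not_eq_false] at hd
  exact h ⟨t, by simpa [thrown, hd] using occupant_eq_of_not_mem_range h ht⟩

theorem exists_not_mem_range_of_eventually_false {d : ℕ → Bool}
    (h : ∀ᶠ t in Filter.atTop, d t = false) : ∃ s, s ∉ Set.range (thrown d) := by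
  obtain ⟨t₀, ht₀⟩ := Filter.eventually_atTop.1 h
  have hocc : ∀ t ≥ t₀, occupant d t = occupant d t₀ := by
    intro t ht
    induction t, ht using Nat.le_induction with
    | base => rfl
    | succ t ht ih => rw [occupant_succ, ht₀ t ht, cond_false, ih]
  refine ⟨occupant d t₀, ?_⟩
  rintro ⟨u, hu⟩
  exact thrown_ne_occupant (d := d) (Nat.lt_succ_of_le (le_max_left u t₀))
    (hu.trans (hocc _ ((le_max_right u t₀).trans (Nat.le_succ _))).symm)

theorem eq_of_not_mem_range {d : ℕ → Bool} {s s' : ℕ} (h : s ∉ Set.range (thrown d))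
    (h' : s' ∉ Set.range (thrown d)) : s = s' :=
  (occupant_eq_of_not_mem_range h (le_max_left s s')).symm.trans
    (occupant_eq_of_not_mem_range h' (le_max_right s s'))

/-! ### Blocks, and why sharing one is `Π⁰₁` -/

/-- The block at stage `u` of the element `x = (p, s)`: the block owning the position `p` until `x` is
thrown out, and the block labelled by that event from then on. -/
def blockAt (d : ℕ → ℕ → Bool) (u x : ℕ) : ℕ :=
  Nat.rec x.unpair.1.unpair.1
    (fun t b => cond (thrown (d x.unpair.1) t == x.unpair.2) (Nat.pair x.unpair.1 t) b) u

open Classical in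
/-- The final block of the element `x`. -/
noncomputable def block (d : ℕ → ℕ → Bool) (x : ℕ) : ℕ :=
  if h : ∃ t, thrown (d x.unpair.1) t = x.unpair.2 then Nat.pair x.unpair.1 h.choose
  else x.unpair.1.unpair.1

section block

variable {d : ℕ → ℕ → Bool} {x t u : ℕ}

theorem block_of_thrown (h : thrown (d x.unpair.1) t = x.unpair.2) :
    block d x = Nat.pair x.unpair.1 t := by
  have h' : ∃ t, thrown (d x.unpair.1) t = x.unpair.2 := ⟨t, h⟩
  rw [block, dif_pos h', thrown_injective _ (h'.choose_spec.trans h.symm)]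

theorem block_of_not_mem_range (h : x.unpair.2 ∉ Set.range (thrown (d x.unpair.1))) :
    block d x = x.unpair.1.unpair.1 := by
  exact dif_neg h

theorem blockAt_of_forall_ne (h : ∀ t < u, thrown (d x.unpair.1) t ≠ x.unpair.2) :
    blockAt d u x = x.unpair.1.unpair.1 := by
  induction u with
  | zero => rfl
  | succ u ih =>
    change cond (thrown (d x.unpair.1) u == x.unpair.2) _ (blockAt d u x) = _
    rw [beq_false_of_ne (h u (Nat.lt_succ_self u)), cond_false]
    exact ih fun t ht => h t (ht.trans (Nat.lt_succ_self u))

theorem blockAt_of_thrown (h : thrown (d x.unpair.1) t = x.unpair.2) (htu : t < u) :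
    blockAt d u x = Nat.pair x.unpair.1 t := by
  induction u, htu using Nat.le_induction with
  | base =>
    change cond (thrown (d x.unpair.1) t == x.unpair.2) _ (blockAt d t x) = _
    rw [h, beq_self_eq_true, cond_true]
  | succ u hu ih =>
    change cond (thrown (d x.unpair.1) u == x.unpair.2) _ (blockAt d u x) = _
    have : thrown (d x.unpair.1) u ≠ x.unpair.2 := fun h' =>
      absurd (thrown_injective _ (h.trans h'.symm)) (by omega)
    rw [beq_false_of_ne this, cond_false]
    exact ih

theorem blockAt_eq_block_or (d : ℕ → ℕ → Bool) (u x : ℕ) : blockAt d u x = block d x ∨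
    blockAt d u x = x.unpair.1.unpair.1 ∧
      ∃ t, u ≤ t ∧ thrown (d x.unpair.1) t = x.unpair.2 ∧ block d x = Nat.pair x.unpair.1 t := by
  by_cases h : ∃ t, thrown (d x.unpair.1) t = x.unpair.2
  · obtain ⟨t, ht⟩ := h
    rcases lt_or_ge t u with htu | htu
    · exact Or.inl ((blockAt_of_thrown ht htu).trans (block_of_thrown ht).symm)
    · refine Or.inr ⟨blockAt_of_forall_ne fun t' ht' h' => ?_, t, htu, ht, block_of_thrown ht⟩
      exact absurd (thrown_injective _ (h'.trans ht.symm)) (by omega)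
  · exact Or.inl ((blockAt_of_forall_ne fun t _ ht => h ⟨t, ht⟩).trans
      (block_of_not_mem_range h).symm)

theorem exists_forall_blockAt_eq (d : ℕ → ℕ → Bool) (x : ℕ) :
    ∃ u₀, ∀ u ≥ u₀, blockAt d u x = block d x := by
  by_cases h : ∃ t, thrown (d x.unpair.1) t = x.unpair.2
  · obtain ⟨t, ht⟩ := h
    exact ⟨t + 1, fun u hu => (blockAt_of_thrown ht hu).trans (block_of_thrown ht).symm⟩
  · exact ⟨0, fun u _ => (blockAt_of_forall_ne fun t _ ht => h ⟨t, ht⟩).trans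
      (block_of_not_mem_range h).symm⟩

theorem eq_of_thrown_of_block_eq {x y t t' : ℕ} (hx : thrown (d x.unpair.1) t = x.unpair.2)
    (hy : thrown (d y.unpair.1) t' = y.unpair.2) (h : block d x = block d y) : x = y := by
  rw [block_of_thrown hx, block_of_thrown hy, Nat.pair_eq_pair] at h
  obtain ⟨h1, rfl⟩ := h
  rw [← Nat.pair_unpair x, ← Nat.pair_unpair y, ← hx, ← hy, h1]

/-- The label satisfies `Nat.pair p t ≥ t ≥ u > y`, while the initial block of `y` is at most `y`.
So `y` must itself be a founder, and a block has only one. -/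
theorem block_eq_block_of_thrown_late {x y : ℕ} (hy : y < u) (hut : u ≤ t)
    (ht : thrown (d x.unpair.1) t = x.unpair.2) (h : block d x = block d y) : x = y := by
  by_cases h' : ∃ t, thrown (d y.unpair.1) t = y.unpair.2
  · exact eq_of_thrown_of_block_eq ht h'.choose_spec h
  · rw [block_of_thrown ht, block_of_not_mem_range h'] at h
    have h1 : y.unpair.1.unpair.1 ≤ y := (Nat.unpair_left_le _).trans (Nat.unpair_left_le _)
    have h2 := Nat.right_le_pair x.unpair.1 t
    omega

theorem block_eq_block_iff {x y : ℕ} :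
    block d x = block d y ↔ ∀ u, x < u → y < u → blockAt d u x = blockAt d u y := by
  constructor
  · intro h u hx hy
    rcases blockAt_eq_block_or d u x with h1 | ⟨-, t, hut, ht, -⟩
    · rcases blockAt_eq_block_or d u y with h2 | ⟨-, t, hut, ht, -⟩
      · rw [h1, h2, h]
      · rw [block_eq_block_of_thrown_late hx hut ht h.symm]
    · rw [block_eq_block_of_thrown_late hy hut ht h]
  · intro h
    obtain ⟨u, hu⟩ := exists_forall_blockAt_eq d x
    obtain ⟨v, hv⟩ := exists_forall_blockAt_eq d y
    rw [← hu (max (max u v) (max x y + 1)) (by omega), ← hv (max (max u v) (max x y + 1)) (by omega)]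
    exact h _ (by omega) (by omega)

end block

theorem Computable.occupant {d : ℕ → ℕ → Bool} (hd : Computable₂ d) :
    Computable₂ fun p t => occupant (d p) t := by
  refine Computable.nat_rec (α := ℕ × ℕ) (f := Prod.snd) (g := fun _ => (0 : ℕ))
    (h := fun (x : ℕ × ℕ) (q : ℕ × ℕ) => _root_.cond (d x.1 q.1) (q.1 + 1) q.2)
    Computable.snd (Computable.const _) ?_
  have hq : Computable fun x : (ℕ × ℕ) × ℕ × ℕ => x.2.1 := Computable.fst.comp Computable.snd
  exact Computable.cond (hd.comp (Computable.fst.comp Computable.fst) hq)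
    (Computable.succ.comp hq) (Computable.snd.comp Computable.snd)

theorem Computable.thrown {d : ℕ → ℕ → Bool} (hd : Computable₂ d) :
    Computable₂ fun p t => thrown (d p) t :=
  Computable.cond (hd.comp Computable.fst Computable.snd)
    ((Computable.occupant hd).comp Computable.fst Computable.snd)
    (Computable.succ.comp Computable.snd)

theorem Computable.blockAt {d : ℕ → ℕ → Bool} (hd : Computable₂ d) : Computable₂ (blockAt d) := by
  have hp : Computable fun x : ℕ => x.unpair.1 := Computable.fst.comp Computable.unpair
  have hs : Computable fun x : ℕ => x.unpair.2 := Computable.snd.comp Computable.unpair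
  refine Computable.nat_rec (α := ℕ × ℕ) (f := Prod.fst)
    (g := fun x : ℕ × ℕ => x.2.unpair.1.unpair.1)
    (h := fun (x : ℕ × ℕ) (q : ℕ × ℕ) => _root_.cond
      (_root_.thrown (d x.2.unpair.1) q.1 == x.2.unpair.2) (Nat.pair x.2.unpair.1 q.1) q.2)
    Computable.fst (hp.comp (hp.comp Computable.snd)) ?_
  have hx : Computable fun x : (ℕ × ℕ) × ℕ × ℕ => x.1.2 := Computable.snd.comp Computable.fst
  have hq : Computable fun x : (ℕ × ℕ) × ℕ × ℕ => x.2.1 := Computable.fst.comp Computable.snd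
  exact Computable.cond
    (((Computable.thrown hd).comp (hp.comp hx) hq).natBeq (hs.comp hx))
    ((hp.comp hx).natPair hq) (Computable.snd.comp Computable.snd)

theorem isPi0_block_eq_block {d : ℕ → ℕ → Bool} (hd : Computable₂ d) :
    IsPi0 1 fun p : ℕ × ℕ => block d p.1 = block d p.2 := by
  have hu : Computable fun a : (ℕ × ℕ) × ℕ => a.1.1 + a.1.2 + a.2 + 1 :=
    Computable.succ.comp ((Primrec.nat_add.to_comp : Computable₂ _).comp
      ((Primrec.nat_add.to_comp : Computable₂ _).comp (Computable.fst.comp Computable.fst)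
        (Computable.snd.comp Computable.fst)) Computable.snd)
  refine isPi0_one_iff.2 ⟨fun a => blockAt d (a.1.1 + a.1.2 + a.2 + 1) a.1.1 ==
    blockAt d (a.1.1 + a.1.2 + a.2 + 1) a.1.2,
    ((Computable.blockAt hd).comp hu (Computable.fst.comp Computable.fst)).natBeq
      ((Computable.blockAt hd).comp hu (Computable.snd.comp Computable.fst)), fun p => ?_⟩
  simp only [block_eq_block_iff, beq_iff_eq]
  constructor
  · exact fun h m => h _ (by omega) (by omega)
  -- The stages tested are cofinal, so they compare the final blocks.
  · intro h u hx hy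
    obtain ⟨v, hv⟩ := exists_forall_blockAt_eq d p.1
    obtain ⟨w, hw⟩ := exists_forall_blockAt_eq d p.2
    have key : block d p.1 = block d p.2 := by
      have := h (v + w)
      rwa [hv _ (by omega), hw _ (by omega)] at this
    exact block_eq_block_iff.1 key u hx hy

/-! ### The isomorphism -/

/-- If `cls` numbers the classes of an equivalence relation on `ℕ` by all natural numbers, `c` picks
an element of each class, and membership of `i` in `cls ⁻¹' {k} \ {c k}` is `Σ⁰₂` as witnessed by `d`,
then the equivalence relation is isomorphic to a `Π⁰₁` one. -/
theorem exists_isPi0_relIso {cls c : ℕ → ℕ} (hc : ∀ k, cls (c k) = k) {d : ℕ → ℕ → Bool}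
    (hd : Computable₂ d)
    (h : ∀ k i, (∀ᶠ t in Filter.atTop, d (Nat.pair k i) t = false) ↔ cls i = k ∧ i ≠ c k) :
    ∃ S : ℕ → ℕ → Prop, (IsPi0 1 fun p : ℕ × ℕ => S p.1 p.2) ∧
      Nonempty (S ≃r fun x y => cls x = cls y) := by
  classical
  refine ⟨fun x y => block d x = block d y, isPi0_block_eq_block hd, ?_⟩
  -- A founder goes to the chosen element of its class, the permanent occupant of position `Nat.pair
  -- k i` to `i`.
  let Φ : ℕ → ℕ := fun x : ℕ =>
    if x.unpair.2 ∈ Set.range (thrown (d x.unpair.1)) then c (block d x) else x.unpair.1.unpair.2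
  have hperm : ∀ x : ℕ, x.unpair.2 ∉ Set.range (thrown (d x.unpair.1)) →
      cls x.unpair.1.unpair.2 = x.unpair.1.unpair.1 ∧
        x.unpair.1.unpair.2 ≠ c x.unpair.1.unpair.1 := by
    intro x hx
    rw [← h, Nat.pair_unpair]
    exact eventually_false_of_not_mem_range hx
  have hcls : ∀ x, cls (Φ x) = block d x := by
    intro x
    by_cases hx : x.unpair.2 ∈ Set.range (thrown (d x.unpair.1))
    · simp only [Φ, if_pos hx, hc]
    · simp only [Φ, if_neg hx, block_of_not_mem_range hx, (hperm x hx).1]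
  have hinj : Function.Injective Φ := by
    intro x y hxy
    have hb : block d x = block d y := by rw [← hcls, ← hcls, hxy]
    by_cases hx : x.unpair.2 ∈ Set.range (thrown (d x.unpair.1)) <;>
      by_cases hy : y.unpair.2 ∈ Set.range (thrown (d y.unpair.1))
    · exact eq_of_thrown_of_block_eq hx.choose_spec hy.choose_spec hb
    · simp only [Φ, if_pos hx, if_neg hy] at hxy
      rw [hb, block_of_not_mem_range hy] at hxy
      exact absurd hxy.symm (hperm y hy).2
    · simp only [Φ, if_neg hx, if_pos hy] at hxy
      rw [← hb, block_of_not_mem_range hx] at hxy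
      exact absurd hxy (hperm x hx).2
    · simp only [Φ, if_neg hx, if_neg hy] at hxy
      rw [block_of_not_mem_range hx, block_of_not_mem_range hy] at hb
      have hp : x.unpair.1 = y.unpair.1 := by
        rw [← Nat.pair_unpair x.unpair.1, ← Nat.pair_unpair y.unpair.1, hb, hxy]
      rw [← Nat.pair_unpair x, ← Nat.pair_unpair y, hp]
      rw [hp] at hx
      rw [eq_of_not_mem_range hx hy]
  have hsurj : Function.Surjective Φ := by
    intro y
    by_cases hy : y = c (cls y)
    -- The founder of block `cls y` is found by decoding this label as a position and a stage.
    · refine ⟨Nat.pair (cls y).unpair.1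
        (thrown (d (cls y).unpair.1) (cls y).unpair.2), ?_⟩
      have hx : thrown (d (Nat.pair (cls y).unpair.1
          (thrown (d (cls y).unpair.1) (cls y).unpair.2)).unpair.1) (cls y).unpair.2 =
          (Nat.pair (cls y).unpair.1 (thrown (d (cls y).unpair.1) (cls y).unpair.2)).unpair.2 := by
        simp only [Nat.unpair_pair]
      simp only [Φ]
      rw [if_pos ⟨_, hx⟩, block_of_thrown hx]
      simpa only [Nat.unpair_pair, Nat.pair_unpair] using hy.symm
    · obtain ⟨s, hs⟩ := exists_not_mem_range_of_eventually_false ((h (cls y) y).2 ⟨rfl, hy⟩)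
      refine ⟨Nat.pair (Nat.pair (cls y) y) s, ?_⟩
      simp only [Φ, Nat.unpair_pair, if_neg hs]
  refine ⟨⟨Equiv.ofBijective Φ ⟨hinj, hsurj⟩, fun {x y} => ?_⟩⟩
  change cls (Φ x) = cls (Φ y) ↔ block d x = block d y
  rw [hcls, hcls]

/-! ### Least representatives and approximations to class membership -/

section Representatives

variable {R : ℕ → ℕ → Prop}

/-- `y` is the least element of its `R`-class. -/
def IsLeastRep (R : ℕ → ℕ → Prop) (y : ℕ) : Prop := ∀ z < y, ¬ R z y

theorem exists_leastRep (hR : Equivalence R) :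
    ∃ rep : ℕ → ℕ, (∀ x, IsLeastRep R (rep x)) ∧ (∀ x, R (rep x) x) ∧
      ∀ x y, R x y ↔ rep x = rep y := by
  classical
  have hex : ∀ x, ∃ y, R y x := fun x => ⟨x, hR.refl x⟩
  refine ⟨fun x => Nat.find (hex x), fun x z hz h =>
    Nat.find_min (hex x) hz (hR.trans h (Nat.find_spec (hex x))),
    fun x => Nat.find_spec (hex x), fun x y => ⟨fun h => ?_, fun h => ?_⟩⟩
  · exact Nat.find_congr' fun {z} => ⟨fun hz => hR.trans hz h, fun hz => hR.trans hz (hR.symm h)⟩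
  · have h1 := Nat.find_spec (hex x)
    simp only at h
    rw [h] at h1
    exact hR.trans (hR.symm h1) (Nat.find_spec (hex y))

theorem IsLeastRep.eq (hR : Equivalence R) {x y : ℕ} (hx : IsLeastRep R x) (hy : IsLeastRep R y)
    (h : R x y) : x = y := by
  rcases lt_trichotomy x y with h1 | h1 | h1
  exacts [absurd h (hy x h1), h1, absurd (hR.symm h) (hx y h1)]

/-- The decision of `IsLeastRep T y` for a Boolean relation `T`. -/
def leastRepTest (T : ℕ → ℕ → Bool) (y : ℕ) : Bool := boundedAll (fun z => !T z y) y

/-- The number of `z < y` passing `leastRepTest T`. -/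
def leastRepCount (T : ℕ → ℕ → Bool) (y : ℕ) : ℕ :=
  Nat.rec 0 (fun z n => cond (leastRepTest T z) (n + 1) n) y

/-- For a Boolean equivalence relation `T`, the assertion that `i` lies in the `k`-th class and is not
the least element there. -/
def memberTest (T : ℕ → ℕ → Bool) (k i : ℕ) : Bool :=
  !leastRepTest T i &&
    !boundedAll (fun c => !(leastRepTest T c && (leastRepCount T c == k && T c i))) i

section correct

variable {T : ℕ → ℕ → Bool} {i : ℕ}

theorem leastRepTest_iff (hT : ∀ a ≤ i, ∀ b ≤ i, (T a b = true ↔ R a b)) {y : ℕ} (hy : y ≤ i) :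
    leastRepTest T y = true ↔ IsLeastRep R y := by
  rw [leastRepTest, boundedAll_eq_true]
  refine forall₂_congr fun z hz => ?_
  rw [← hT z (by omega) y hy, Bool.not_eq_true', Bool.not_eq_true]

open Classical in
theorem leastRepCount_eq (hT : ∀ a ≤ i, ∀ b ≤ i, (T a b = true ↔ R a b)) {y : ℕ} (hy : y ≤ i) :
    leastRepCount T y = Nat.count (IsLeastRep R) y := by
  induction y with
  | zero => simp [leastRepCount]
  | succ y ih =>
    rw [Nat.count_succ, ← ih (by omega)]
    change cond (leastRepTest T y) (leastRepCount T y + 1) (leastRepCount T y) = _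
    have := leastRepTest_iff hT (y := y) (by omega)
    cases h : leastRepTest T y <;> simp [← this, h]

-- The test consults `T` only on arguments up to `i`, so agreement with `R` on that finite square
-- suffices; `T` need not be an equivalence relation elsewhere.
open Classical in
theorem memberTest_iff (hT : ∀ a ≤ i, ∀ b ≤ i, (T a b = true ↔ R a b)) {k : ℕ} :
    memberTest T k i = true ↔ ¬ IsLeastRep R i ∧
      ∃ c < i, IsLeastRep R c ∧ Nat.count (IsLeastRep R) c = k ∧ R c i := by
  rw [memberTest, Bool.and_eq_true, Bool.not_eq_true', ← Bool.not_eq_true, leastRepTest_iff hT le_rfl,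
    Bool.not_eq_true', ← Bool.not_eq_true, boundedAll_eq_true]
  refine and_congr_right fun _ => ?_
  push Not
  refine exists_congr fun c => and_congr_right fun hc => ?_
  rw [ne_eq, Bool.not_eq_true, Bool.not_eq_false', Bool.and_eq_true, Bool.and_eq_true, beq_iff_eq,
    leastRepTest_iff hT hc.le, leastRepCount_eq hT hc.le, hT c hc.le i le_rfl]

end correct

section computable

variable {α : Type} [Primcodable α] {T : α → ℕ → ℕ → Bool}

theorem Computable.leastRepTest (hT : Computable fun x : α × ℕ × ℕ => T x.1 x.2.1 x.2.2) :
    Computable₂ fun a y => leastRepTest (T a) y := by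
  refine Computable.boundedAll (α := α × ℕ) (f := fun x z => !T x.1 z x.2) (g := Prod.snd) ?_
    Computable.snd
  exact (hT.comp ((Computable.fst.comp Computable.fst).pair
    (Computable.snd.pair (Computable.snd.comp Computable.fst)))).not'

theorem Computable.leastRepCount (hT : Computable fun x : α × ℕ × ℕ => T x.1 x.2.1 x.2.2) :
    Computable₂ fun a y => leastRepCount (T a) y := by
  refine Computable.nat_rec (α := α × ℕ) (f := Prod.snd) (g := fun _ => (0 : ℕ))
    (h := fun (x : α × ℕ) (q : ℕ × ℕ) => _root_.cond (_root_.leastRepTest (T x.1) q.1) (q.2 + 1) q.2)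
    Computable.snd (Computable.const _) ?_
  have hn : Computable fun x : (α × ℕ) × ℕ × ℕ => x.2.2 := Computable.snd.comp Computable.snd
  exact Computable.cond ((Computable.leastRepTest hT).comp (Computable.fst.comp Computable.fst)
    (Computable.fst.comp Computable.snd)) (Computable.succ.comp hn) hn

theorem Computable.memberTest (hT : Computable fun x : α × ℕ × ℕ => T x.1 x.2.1 x.2.2) :
    Computable fun x : α × ℕ × ℕ => memberTest (T x.1) x.2.1 x.2.2 := by
  have hi : Computable fun x : α × ℕ × ℕ => x.2.2 := Computable.snd.comp Computable.snd
  refine ((Computable.leastRepTest hT).comp Computable.fst hi).not'.and' (Computable.not' ?_)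
  refine Computable.boundedAll (α := α × ℕ × ℕ) (f := fun x c =>
    !(_root_.leastRepTest (T x.1) c && (_root_.leastRepCount (T x.1) c == x.2.1 && T x.1 c x.2.2)))
    ?_ hi
  have ha : Computable fun x : (α × ℕ × ℕ) × ℕ => x.1.1 := Computable.fst.comp Computable.fst
  exact (((Computable.leastRepTest hT).comp ha Computable.snd).and'
    ((((Computable.leastRepCount hT).comp ha Computable.snd).natBeq
      (Computable.fst.comp (Computable.snd.comp Computable.fst))).and'
      (hT.comp (ha.pair (Computable.snd.pair (hi.comp Computable.fst)))))).not'

end computable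

/-- Infinitely many classes are needed because every number labels a block, and so must number a
class. -/
theorem exists_isPi0_relIso_of_infinite (hR : Equivalence R)
    (hΔ : IsDelta0 2 fun p : ℕ × ℕ => R p.1 p.2) (hinf : {y | IsLeastRep R y}.Infinite) :
    ∃ S : ℕ → ℕ → Prop, (IsPi0 1 fun p : ℕ × ℕ => S p.1 p.2) ∧ Nonempty (S ≃r R) := by
  classical
  obtain ⟨r, hr, hlim⟩ := hΔ.exists_computable_limit
  obtain ⟨rep, hleast, hrep, hiff⟩ := exists_leastRep hR
  have hrep_eq : ∀ y, IsLeastRep R y → rep y = y := fun y hy => (hleast y).eq hR hy (hrep y)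
  let T : ℕ → ℕ → ℕ → Bool := fun t a b => r (a, b) t
  have hT : Computable fun x : ℕ × ℕ × ℕ => T x.1 x.2.1 x.2.2 := hr.comp Computable.snd Computable.fst
  let cls : ℕ → ℕ := fun x => Nat.count (IsLeastRep R) (rep x)
  let c : ℕ → ℕ := Nat.nth (IsLeastRep R)
  have hcmem : ∀ k, IsLeastRep R (c k) := fun k => Nat.nth_mem_of_infinite hinf k
  have hc : ∀ k, cls (c k) = k := fun k => by
    simp only [cls]
    rw [hrep_eq _ (hcmem k)]
    exact Nat.count_nth_of_infinite hinf k
  have hcls : ∀ x y, cls x = cls y ↔ R x y := fun x y => by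
    rw [hiff]
    exact ⟨fun h => Nat.count_injective (hleast x) (hleast y) h, fun h => by simp only [cls, h]⟩
  have hmem : ∀ k i, (¬ IsLeastRep R i ∧
      ∃ c < i, IsLeastRep R c ∧ Nat.count (IsLeastRep R) c = k ∧ R c i) ↔ cls i = k ∧ i ≠ c k := by
    intro k i
    constructor
    · rintro ⟨hi, z, -, hz, rfl, hzi⟩
      refine ⟨?_, fun h => hi (h ▸ hcmem _)⟩
      rw [← (hcls z i).2 hzi]
      simp only [cls, hrep_eq z hz]
    · rintro ⟨rfl, hi⟩
      have hni : ¬ IsLeastRep R i := fun h => hi <| by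
        simp only [c, cls, hrep_eq i h, Nat.nth_count h]
      refine ⟨hni, rep i, ?_, hleast i, rfl, hrep i⟩
      rcases lt_trichotomy (rep i) i with h | h | h
      · exact h
      · exact absurd (h ▸ hleast i) hni
      · exact absurd (hR.symm (hrep i)) (hleast i i h)
  have hd : Computable₂ fun p t : ℕ => !memberTest (T t) p.unpair.1 p.unpair.2 :=
    ((Computable.memberTest hT).comp
      (Computable.snd.pair (Computable.unpair.comp Computable.fst))).not'
  obtain ⟨S, hS, ⟨e⟩⟩ := exists_isPi0_relIso hc hd fun k i => by
    simp only [Nat.unpair_pair, Bool.not_eq_false']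
    rw [← hmem]
    -- The limit lemma gives a stage for each pair; finitely many pairs have a common one.
    have hev : ∀ᶠ t in Filter.atTop, ∀ a ≤ i, ∀ b ≤ i, (T t a b = true ↔ R a b) :=
      (Filter.eventually_all_finite (Set.finite_Iic i)).2 fun a _ =>
        (Filter.eventually_all_finite (Set.finite_Iic i)).2 fun b _ => hlim (a, b)
    have hev' := hev.mono fun t ht => memberTest_iff ht (k := k)
    refine ⟨fun h => ?_, fun h => hev'.mono fun t ht => ht.2 h⟩
    obtain ⟨t, ht, ht'⟩ := (h.and hev').exists
    exact ht'.1 ht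
  exact ⟨S, hS, ⟨e.trans ⟨Equiv.refl ℕ, fun {x y} => (hcls x y).symm⟩⟩⟩

/-! ### Finitely many classes -/

/-- The finite fibres lie below some bound, where a finite table copies `f`. Beyond it, cycling
through the values with infinite fibres keeps those fibres infinite and the others unchanged. -/
theorem exists_computable_relIso_of_finite_range {f : ℕ → ℕ} (hf : (Set.range f).Finite) :
    ∃ g : ℕ → ℕ, Computable g ∧ Nonempty ((fun x y => g x = g y) ≃r fun x y => f x = f y) := by
  classical
  have hIfin : {v | (f ⁻¹' {v}).Infinite}.Finite := hf.subset fun v hv => by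
    obtain ⟨x, hx⟩ := Set.Infinite.nonempty hv
    exact ⟨x, hx⟩
  have hbdd : {x | (f ⁻¹' {f x}).Finite}.Finite := by
    have : {x | (f ⁻¹' {f x}).Finite} =
        ⋃ v ∈ Set.range f ∩ {v | (f ⁻¹' {v}).Finite}, f ⁻¹' {v} := by
      ext x
      simp
    rw [this]
    exact (hf.inter_of_left _).biUnion fun v hv => hv.2
  obtain ⟨N, hN⟩ := hbdd.bddAbove
  have hlarge : ∀ x, N < x → (f ⁻¹' {f x}).Infinite := fun x hx h => absurd (hN h) (by omega)
  let I : List ℕ := hIfin.toFinset.toList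
  have hI : ∀ v, v ∈ I ↔ (f ⁻¹' {v}).Infinite := fun v => by simp [I]
  have hIpos : 0 < I.length := List.length_pos_of_mem ((hI _).2 (hlarge (N + 1) (by omega)))
  let L : List ℕ := (List.range (N + 1)).map f
  -- The outer default takes over past the table; the inner `0` is never reached, as `I` is
  -- nonempty.
  let g : ℕ → ℕ := fun y => (L[y]?).getD ((I[y % I.length]?).getD 0)
  have hg : Computable g := by
    have hmod : Computable fun y : ℕ => y % I.length :=
      (Primrec.nat_mod.to_comp : Computable₂ ((· % ·) : ℕ → ℕ → ℕ)).comp Computable.id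
        (Computable.const _)
    exact Computable.option_getD (Computable.list_getElem?.comp (Computable.const L) Computable.id)
      (Computable.option_getD (Computable.list_getElem?.comp (Computable.const I) hmod)
        (Computable.const 0))
  have hgs : ∀ y ≤ N, g y = f y := fun y hy => by
    simp [g, L, List.getElem?_range (show y < N + 1 by omega)]
  have hgl : ∀ y, N < y → g y = I[y % I.length]'(Nat.mod_lt _ hIpos) := fun y hy => by
    have : L[y]? = none := List.getElem?_eq_none (by simp [L]; omega)
    simp [g, this, List.getElem?_eq_getElem (Nat.mod_lt y hIpos)]
  have hfib : ∀ v, Nonempty ({x // g x = v} ≃ {x // f x = v}) := by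
    intro v
    by_cases hv : (f ⁻¹' {v}).Infinite
    · have hgv : (g ⁻¹' {v}).Infinite := by
        obtain ⟨j, hj, rfl⟩ := List.getElem_of_mem ((hI v).2 hv)
        refine Set.infinite_of_forall_exists_gt fun a => ?_
        -- A multiple of `I.length` preserves the residue `j`, and the factor `a + N + 1` pushes the
        -- point past both `a` and `N`.
        refine ⟨j + I.length * (a + N + 1), ?_, ?_⟩
        · have h1 := Nat.le_mul_of_pos_left (a + N + 1) hIpos
          rw [Set.mem_preimage, hgl _ (by omega), Set.mem_singleton_iff]
          simp only [Nat.add_mul_mod_self_left, Nat.mod_eq_of_lt hj]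
        · have h1 := Nat.le_mul_of_pos_left (a + N + 1) hIpos
          omega
      have : Infinite {x // g x = v} := hgv.to_subtype
      have : Infinite {x // f x = v} := hv.to_subtype
      exact nonempty_equiv_of_countable
    · refine ⟨Equiv.subtypeEquivRight fun x => ?_⟩
      rcases le_or_gt x N with hx | hx
      · rw [hgs x hx]
      · have h1 : (f ⁻¹' {g x}).Infinite := by
          rw [hgl x hx]
          exact (hI _).1 (List.getElem_mem _)
        exact ⟨fun h => absurd (h ▸ h1) hv, fun h => absurd (h ▸ hlarge x hx) hv⟩
  let e := (Equiv.sigmaFiberEquiv g).symm.trans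
    ((Equiv.sigmaCongrRight fun v => (hfib v).some).trans (Equiv.sigmaFiberEquiv f))
  have he : ∀ x, f (e x) = g x := fun x => ((hfib (g x)).some ⟨x, rfl⟩).2
  exact ⟨g, hg, ⟨⟨e, fun {x y} => by simp only [he]⟩⟩⟩

theorem exists_isPi0_relIso_of_finite (hR : Equivalence R) (hfin : {y | IsLeastRep R y}.Finite) :
    ∃ S : ℕ → ℕ → Prop, (IsPi0 1 fun p : ℕ × ℕ => S p.1 p.2) ∧ Nonempty (S ≃r R) := by
  obtain ⟨rep, hleast, -, hiff⟩ := exists_leastRep hR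
  obtain ⟨g, hg, ⟨e⟩⟩ := exists_computable_relIso_of_finite_range (f := rep)
    (hfin.subset (by rintro _ ⟨x, rfl⟩; exact hleast x))
  refine ⟨fun x y => g x = g y, isPi0_one_iff.2 ⟨fun a => g a.1.1 == g a.1.2,
    (hg.comp (Computable.fst.comp Computable.fst)).natBeq
      (hg.comp (Computable.snd.comp Computable.fst)), fun p => by simp⟩,
    ⟨e.trans ⟨Equiv.refl ℕ, fun {x y} => hiff x y⟩⟩⟩

end Representatives

theorem mainTheorem2 :
    IsoType EQ (fun P => IsPi0 1 P) = IsoType EQ (fun P => IsDelta0 2 P) := by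
  refine Set.Subset.antisymm (Set.image_mono fun R hR => ⟨hR.1, hR.2.isDelta0_two⟩) ?_
  rintro _ ⟨R, ⟨hR, hΔ⟩, rfl⟩
  have hRe : Equivalence R := hR
  obtain ⟨S, hS, ⟨e⟩⟩ : ∃ S : ℕ → ℕ → Prop, (IsPi0 1 fun p : ℕ × ℕ => S p.1 p.2) ∧
      Nonempty (S ≃r R) := by
    by_cases hfin : {y | IsLeastRep R y}.Finite
    · exact exists_isPi0_relIso_of_finite hRe hfin
    · exact exists_isPi0_relIso_of_infinite hRe hΔ hfin
  refine ⟨S, ⟨⟨fun x => ?_, fun {x y} h => ?_, fun {x y z} h h' => ?_⟩, hS⟩, Quotient.sound ⟨e⟩⟩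
  · exact e.map_rel_iff.1 (hRe.refl _)
  · exact e.map_rel_iff.1 (hRe.symm (e.map_rel_iff.2 h))
  · exact e.map_rel_iff.1 (hRe.trans (e.map_rel_iff.2 h) (e.map_rel_iff.2 h'))
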